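/- Let $\mathbb T$ be the unit circle with normalized arc length, let $H^2\subset L^2(\mathbb T)$ be the Hardy space (functions whose negative Fourier coefficients vanish; equivalently, via $f(z)=\sum_{n\ge 0}\hat f(n)z^n$, holomorphic functions on the open unit disc $\mathbb D$ with square-summable Taylor coefficients), and let $\mathbb P:L^2(\mathbb T)\to H^2$ be the Riesz (orthogonal) projection. Let $\mathrm{Rat}(\mathbb T)$ be the set of complex rational functions all of whose poles in $\mathbb C$ lie on $\mathbb T$, and $\mathrm{Rat}_0(\mathbb T)$ the subset of strictly proper ones (the degree of the numerator is smaller than that of the denominator; this includes $0$). For $\omega\in\mathrm{Rat}(\mathbb T)$ let $T_\omega$ be the operator on $H^2$ with $$\mathrm{Dom}(T_\omega)=\{g\in H^2:\ \omega g=f+\rho \text{ a.e. on }\mathbb T\text{ with } f\in L^2(\mathbb T),\ \rho\in\mathrm{Rat}_0(\mathbb T)\},\qquad T_\omega g=\mathbb P f .$$ For a holomorphic function $\varphi$ on $\mathbb D$ let $T^{\mathrm{Sa}}_\varphi$ be Sarason's Toeplitz operator, with domain $\{f\in H^2:\ \varphi f\in H^2\}$ (products taken on $\mathbb D$) and $T^{\mathrm{Sa}}_\varphi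 f=\varphi f$. **Proposition 6.1.** (i) Let $\widetilde\omega=\widetilde s/\widetilde q\in\mathrm{Rat}(\mathbb T)$ with $\widetilde s,\widetilde q$ co-prime complex polynomials, $\widetilde q\neq 0$. Then $\mathrm{Dom}(T^{\mathrm{Sa}}_{\widetilde\omega})=\widetilde q H^2$ and $T^{\mathrm{Sa}}_{\widetilde\omega}=T_{\widetilde\omega}|_{\widetilde q H^2}$. (ii) Let $\omega=s/q\in\mathrm{Rat}(\mathbb T)$, with $s,q$ co-prime polynomials, be proper, i.e. $n:=\deg s\le m:=\deg q$ (or $s=0$). Let $\omega^*(z)=z^{m-n}s^\sharp(z)/q^\sharp(z)$, where $r^\sharp(z)=z^{\deg r}\,\overline{r(1/\bar z)}$ (with $\omega^*=0$ if $\omega=0$), be the rational function that equals $\overline{\omega(z)}$ for $z\in\mathbb T$ not a pole of $\omega$. Then $\omega^*\in\mathrm{Rat}(\mathbb T)$, the operator $T_\omega$ is densely defined, and its Hilbert space adjoint is $T_\omega^*=T^{\mathrm{Sa}}_{\omega^*}$ (equality of domains and of actions). -/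

import Mathlib

open MeasureTheory Polynomial

namespace HardyToeplitz

/-! ### The Hardy space `H²` of the unit circle -/

/-- `L²(𝕋)`. The unit circle `𝕋` is parametrized by `t ∈ ℝ/ℤ` through
`AddCircle.toCircle t = exp(2πit)`; the measure is normalized arc length `dθ/2π`. -/
abbrev L2T : Type := Lp ℂ 2 (AddCircle.haarAddCircle : Measure UnitAddCircle)

/-- The point of the unit circle with parameter `t`, as a complex number. -/
noncomputable def pt (t : UnitAddCircle) : ℂ := (AddCircle.toCircle t : ℂ)

theorem fourierCoeff_add' (f g : L2T) (n : ℤ) :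
    fourierCoeff (f + g : L2T) n = fourierCoeff f n + fourierCoeff g n := by
  simp_rw [← fourierBasis_repr]; simp

theorem fourierCoeff_smul' (c : ℂ) (f : L2T) (n : ℤ) :
    fourierCoeff (c • f : L2T) n = c * fourierCoeff f n := by
  simp_rw [← fourierBasis_repr]; simp

theorem fourierCoeff_zero' (n : ℤ) : fourierCoeff (0 : L2T) n = 0 := by
  rw [← fourierBasis_repr]; simp

/-- The Hardy space `H²`, as the closed subspace of `L²(𝕋)` of the functions whose Fourier
coefficients of negative index vanish. -/
noncomputable def H2 : Submodule ℂ L2T where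
  carrier := {f | ∀ n : ℤ, n < 0 → fourierCoeff f n = 0}
  add_mem' := fun {f g} hf hg n hn => by rw [fourierCoeff_add', hf n hn, hg n hn, add_zero]
  zero_mem' := fun n _ => fourierCoeff_zero' n
  smul_mem' := fun c f hf n hn => by rw [fourierCoeff_smul', hf n hn, mul_zero]

theorem isClosed_H2 : IsClosed (H2 : Set L2T) := by
  have h : (H2 : Set L2T) = ⋂ n : ℤ, ⋂ _ : n < 0, {f : L2T | fourierCoeff f n = 0} := by
    ext f; simp [H2]
  rw [h]
  refine isClosed_iInter fun n => isClosed_iInter fun _ => isClosed_eq ?_ continuous_const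
  simp_rw [← fourierBasis_repr, HilbertBasis.repr_apply_apply]
  fun_prop

instance : CompleteSpace H2 := isClosed_H2.completeSpace_coe

/-- The Riesz projection `ℙ` of `L²(𝕋)` onto `H²`, that is, the orthogonal projection. -/
noncomputable def rieszProj : L2T →L[ℂ] H2 := H2.orthogonalProjectionOnto

/-- The holomorphic function on the open unit disc `𝔻` that corresponds to `f ∈ H²`:
`f(z) = ∑_{n ≥ 0} f̂(n) zⁿ` (only used for `|z| < 1`). -/
noncomputable def disc (f : H2) (z : ℂ) : ℂ := ∑' n : ℕ, fourierCoeff (f : L2T) n * z ^ n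

theorem norm_fourierCoeff_le (f : L2T) (n : ℤ) : ‖fourierCoeff f n‖ ≤ ‖f‖ := by
  rw [← fourierBasis_repr]
  exact (lp.norm_apply_le_norm (by simp) _ _).trans (by simp)

theorem summable_disc (f : H2) {z : ℂ} (hz : ‖z‖ < 1) :
    Summable fun n : ℕ => fourierCoeff (f : L2T) n * z ^ n := by
  refine Summable.of_norm_bounded
    ((summable_geometric_of_lt_one (norm_nonneg z) hz).mul_left ‖(f : L2T)‖) fun n => ?_
  rw [norm_mul, norm_pow]
  gcongr
  exact norm_fourierCoeff_le _ _

theorem disc_add (f g : H2) {z : ℂ} (hz : ‖z‖ < 1) : disc (f + g) z = disc f z + disc g z := by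
  unfold disc
  rw [← (summable_disc f hz).tsum_add (summable_disc g hz)]
  refine tsum_congr fun n => ?_
  rw [Submodule.coe_add, fourierCoeff_add', add_mul]

theorem disc_smul (c : ℂ) (f : H2) (z : ℂ) : disc (c • f) z = c * disc f z := by
  unfold disc
  rw [← tsum_mul_left]
  refine tsum_congr fun n => ?_
  rw [Submodule.coe_smul, fourierCoeff_smul', mul_assoc]

theorem disc_zero (z : ℂ) : disc 0 z = 0 := by
  simpa using disc_smul 0 0 z

/-- An element of `H²` is determined by its values on the disc. -/
theorem eq_zero_of_disc_eq_zero (f : H2) (hf : ∀ z : ℂ, ‖z‖ < 1 → disc f z = 0) : f = 0 := by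
  have h0 : ∀ n : ℕ, fourierCoeff (f : L2T) n = 0 := by
    set p : FormalMultilinearSeries ℂ ℂ ℂ :=
      FormalMultilinearSeries.ofScalars ℂ (fun n : ℕ => fourierCoeff (f : L2T) n) with hp
    have hps : HasFPowerSeriesOnBall (disc f) p 0 1 := by
      refine ⟨?_, by norm_num, ?_⟩
      · refine ENNReal.le_of_forall_nnreal_lt fun r hr => ?_
        refine p.le_radius_of_bound ‖(f : L2T)‖ fun n => ?_
        have hr1 : (r : ℝ) ≤ 1 := by exact_mod_cast hr.le
        have : ‖p n‖ ≤ ‖(f : L2T)‖ := by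
          rw [hp, FormalMultilinearSeries.ofScalars_norm]
          exact norm_fourierCoeff_le _ _
        calc ‖p n‖ * (r : ℝ) ^ n ≤ ‖(f : L2T)‖ * 1 := by
              gcongr
              exact pow_le_one₀ r.2 hr1
          _ = _ := mul_one _
      · intro y hy
        have hy' : ‖y‖ < 1 := by
          rw [Metric.mem_eball, edist_zero_right, enorm_eq_nnnorm] at hy
          exact_mod_cast hy
        have := (summable_disc f hy').hasSum
        simpa [hp, FormalMultilinearSeries.ofScalars, disc, mul_comm] using this
    have hz : disc f =ᶠ[nhds 0] 0 := by
      filter_upwards [Metric.ball_mem_nhds (0 : ℂ) one_pos] with z hz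
      exact hf z (by simpa using hz)
    have := hps.hasFPowerSeriesAt.eq_zero_of_eventually hz
    intro n
    have h2 : p.coeff n = 0 := by rw [this]; rfl
    rw [hp, FormalMultilinearSeries.coeff_ofScalars] at h2
    exact h2
  have h1 : fourierBasis.repr (f : L2T) = 0 := by
    ext n
    rw [fourierBasis_repr]
    rcases lt_or_ge n 0 with hn | hn
    · simpa using f.2 n hn
    · obtain ⟨k, rfl⟩ := Int.eq_ofNat_of_zero_le hn
      simpa using h0 k
  exact Subtype.ext ((LinearIsometryEquiv.map_eq_zero_iff _).1 h1)

/-! ### Sarason's Toeplitz operator -/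

/-- The graph of multiplication by `φ` on `H²`: pairs `(f, g)` of elements of `H²` with
`g = φ f` on `𝔻`. -/
noncomputable def sarasonGraph (φ : ℂ → ℂ) : Submodule ℂ (H2 × H2) where
  carrier := {x | ∀ z : ℂ, ‖z‖ < 1 → disc x.2 z = φ z * disc x.1 z}
  add_mem' := fun {x y} hx hy z hz => by
    rw [Prod.snd_add, Prod.fst_add, disc_add _ _ hz, disc_add _ _ hz, hx z hz, hy z hz, mul_add]
  zero_mem' := fun z _ => by simp [disc_zero]
  smul_mem' := fun c x hx z hz => by
    rw [Prod.smul_snd, Prod.smul_fst, disc_smul, disc_smul, hx z hz]; ring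

theorem sarasonGraph_single (φ : ℂ → ℂ) (x : H2 × H2) (hx : x ∈ sarasonGraph φ)
    (h : x.1 = 0) : x.2 = 0 := by
  refine eq_zero_of_disc_eq_zero _ fun z hz => ?_
  rw [hx z hz, h, disc_zero, mul_zero]

/-- Sarason's Toeplitz operator with symbol `φ` (a function on `𝔻`):
the domain is `{f ∈ H² : φ f ∈ H²}`, and `f` is mapped to `φ f`. -/
noncomputable def sarason (φ : ℂ → ℂ) : H2 →ₗ.[ℂ] H2 := (sarasonGraph φ).toLinearPMap

theorem mem_sarason_domain (φ : ℂ → ℂ) (f : H2) :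
    f ∈ (sarason φ).domain ↔ ∃ g : H2, ∀ z : ℂ, ‖z‖ < 1 → disc g z = φ z * disc f z := by
  simp [sarason, Submodule.toLinearPMap_domain, sarasonGraph]

theorem disc_sarason_apply (φ : ℂ → ℂ) (f : (sarason φ).domain) (z : ℂ) (hz : ‖z‖ < 1) :
    disc (sarason φ f) z = φ z * disc f z :=
  Submodule.mem_graph_toLinearPMap (sarasonGraph_single φ) f z hz

/-! ### Rational functions -/

/-- The value of a rational function at `z` (with value `0` at the poles). -/
noncomputable def ev (ω : RatFunc ℂ) (z : ℂ) : ℂ := ω.eval (RingHom.id ℂ) z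

/-- All roots of `p` lie on the unit circle. -/
def RootsOnCircle (p : ℂ[X]) : Prop := ∀ z : ℂ, p.IsRoot z → ‖z‖ = 1

/-- `Rat(𝕋)`: rational functions all of whose poles (in `ℂ`) lie on the unit circle. -/
def RatT : Set (RatFunc ℂ) := {ω | RootsOnCircle ω.denom}

/-- `Rat₀(𝕋)`: the strictly proper functions in `Rat(𝕋)`. -/
def Rat0T : Set (RatFunc ℂ) := {ω | ω ∈ RatT ∧ ω.num.degree < ω.denom.degree}

/-- A rational function is proper if the degree of its numerator is at most the degree of its
denominator. -/
def IsProper (ω : RatFunc ℂ) : Prop := ω.num.degree ≤ ω.denom.degree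

/-- `r^♯(z) = z^k * conj (r (1 / conj z))` for a polynomial `r` of degree `k`: the polynomial with
the conjugated coefficients in reversed order. -/
noncomputable def sharp (r : ℂ[X]) : ℂ[X] := (r.map (starRingEnd ℂ)).reverse

/-- The rational function `ω^*` with `ω^* = conj ω` on the unit circle, namely
`ω^* = z^(m-n) s^♯ / q^♯` where `ω = s / q` in lowest terms, `n = deg s`, `m = deg q`. -/
noncomputable def ratStar (ω : RatFunc ℂ) : RatFunc ℂ :=
  algebraMap ℂ[X] (RatFunc ℂ) (X ^ ω.denom.natDegree * sharp ω.num) /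
    algebraMap ℂ[X] (RatFunc ℂ) (X ^ ω.num.natDegree * sharp ω.denom)

theorem eval_sharp (r : ℂ[X]) {z : ℂ} (hz : ‖z‖ = 1) :
    (sharp r).eval z = z ^ r.natDegree * (starRingEnd ℂ) (r.eval z) := by
  have hz0 : z ≠ 0 := by rintro rfl; simp at hz
  let i : Invertible z⁻¹ := invertibleOfNonzero (inv_ne_zero hz0)
  have h := eval₂_reverse_mul_pow (RingHom.id ℂ) z⁻¹ (r.map (starRingEnd ℂ))
  have e : (⅟ (z⁻¹) : ℂ) = z := by simp
  have hc : (starRingEnd ℂ) z = z⁻¹ := by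
    rw [Complex.inv_def, Complex.normSq_eq_norm_sq, hz]; simp
  rw [e, natDegree_map, ← hc, eval₂_id, eval₂_id, eval_map, eval₂_hom] at h
  rw [sharp, ← h, hc, inv_pow]
  field_simp

/-- The defining property of `ω^*`: it is the complex conjugate of `ω` on the unit circle
(away from the poles of `ω`). -/
theorem ev_ratStar (ω : RatFunc ℂ) {z : ℂ} (hz : ‖z‖ = 1) (hd : ω.denom.eval z ≠ 0) :
    ev (ratStar ω) z = (starRingEnd ℂ) (ev ω z) := by
  have hz0 : z ≠ 0 := by rintro rfl; simp at hz
  set a : ℂ[X] := X ^ ω.denom.natDegree * sharp ω.num with ha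
  set b : ℂ[X] := X ^ ω.num.natDegree * sharp ω.denom with hb
  have hbz : b.eval z ≠ 0 := by
    rw [hb, eval_mul, eval_sharp _ hz]
    simp [hz0, hd]
  have hb0 : b ≠ 0 := by rintro h; simp [h] at hbz
  have hdz : eval₂ (RingHom.id ℂ) z (ratStar ω).denom ≠ 0 := by
    rw [eval₂_id]
    intro h
    exact hbz (eval_eq_zero_of_dvd_of_eval_eq_zero (RatFunc.denom_div_dvd a b) h)
  have hB : ev (algebraMap ℂ[X] (RatFunc ℂ) b) z = b.eval z := by
    simp [ev, RatFunc.eval_algebraMap, eval₂_id]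
  have hA : ev (algebraMap ℂ[X] (RatFunc ℂ) a) z = a.eval z := by
    simp [ev, RatFunc.eval_algebraMap, eval₂_id]
  have hm : ratStar ω * algebraMap ℂ[X] (RatFunc ℂ) b = algebraMap ℂ[X] (RatFunc ℂ) a :=
    div_mul_cancel₀ _ (RatFunc.algebraMap_ne_zero hb0)
  have h1 : ev (ratStar ω) z * b.eval z = a.eval z := by
    rw [← hA, ← hB, ← hm, ev, ev, ev, RatFunc.eval_mul _ _ hdz (by simp)]
  have h2 : ev ω z = ω.num.eval z / ω.denom.eval z := by
    simp [ev, RatFunc.eval, eval₂_id]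
  rw [eq_div_of_mul_eq hbz h1, h2, map_div₀, ha, hb, eval_mul, eval_mul, eval_sharp _ hz,
    eval_sharp _ hz, eval_pow, eval_pow, eval_X]
  have : (starRingEnd ℂ) (ω.denom.eval z) ≠ 0 := by simpa using hd
  field_simp

theorem RootsOnCircle.of_dvd_mul {p q r : ℂ[X]} (hp : RootsOnCircle p) (hq : RootsOnCircle q)
    (h : r ∣ p * q) : RootsOnCircle r := fun z hz => by
  have h1 : (p * q).IsRoot z := hz.dvd h
  rcases root_mul.1 h1 with h | h
  exacts [hp z h, hq z h]

theorem degree_lt_of_mul_eq {a b c d : ℂ[X]} (hb : b ≠ 0) (h : a * b = c * d)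
    (hd : d ≠ 0) (hc : c.degree < b.degree) : a.degree < d.degree := by
  by_cases hc0 : c = 0
  · have : a = 0 := by simpa [hc0, hb] using h
    rw [this, degree_zero]; exact bot_lt_iff_ne_bot.2 (by simpa using hd)
  have ha0 : a ≠ 0 := by
    rintro rfl
    simp [hc0, hd] at h
  have := congrArg natDegree h
  rw [natDegree_mul ha0 hb, natDegree_mul hc0 hd] at this
  rw [degree_eq_natDegree hc0, degree_eq_natDegree hb, Nat.cast_lt] at hc
  rw [degree_eq_natDegree ha0, degree_eq_natDegree hd, Nat.cast_lt]
  omega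

theorem Rat0T_zero : (0 : RatFunc ℂ) ∈ Rat0T := by
  refine ⟨fun z hz => ?_, ?_⟩ <;> simp_all

theorem Rat0T_add {x y : RatFunc ℂ} (hx : x ∈ Rat0T) (hy : y ∈ Rat0T) : x + y ∈ Rat0T := by
  refine ⟨hx.1.of_dvd_mul hy.1 (RatFunc.denom_add_dvd x y), ?_⟩
  refine degree_lt_of_mul_eq (mul_ne_zero x.denom_ne_zero y.denom_ne_zero)
    (RatFunc.num_denom_add x y) (RatFunc.denom_ne_zero _) ?_
  refine (degree_add_le _ _).trans_lt (max_lt ?_ ?_)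
  · rw [degree_mul, degree_mul]
    exact WithBot.add_lt_add_right (by simpa using y.denom_ne_zero) hx.2
  · rw [degree_mul, degree_mul]
    exact WithBot.add_lt_add_left (by simpa using x.denom_ne_zero) hy.2

theorem Rat0T_C_mul (c : ℂ) {x : RatFunc ℂ} (hx : x ∈ Rat0T) : RatFunc.C c * x ∈ Rat0T := by
  have h1 : RootsOnCircle (RatFunc.C c).denom := fun z hz => by simp at hz
  refine ⟨h1.of_dvd_mul hx.1 (RatFunc.denom_mul_dvd _ x), ?_⟩
  refine degree_lt_of_mul_eq (mul_ne_zero (RatFunc.denom_ne_zero _) x.denom_ne_zero)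
    (RatFunc.num_denom_mul _ x) (RatFunc.denom_ne_zero _) ?_
  rw [RatFunc.num_C, RatFunc.denom_C, one_mul]
  refine lt_of_le_of_lt ?_ hx.2
  rw [degree_mul]
  calc (C c).degree + x.num.degree ≤ 0 + x.num.degree := by
        gcongr
        exact degree_C_le
    _ = _ := zero_add _

theorem ae_eval_ne_zero (p : ℂ[X]) (hp : p ≠ 0) :
    ∀ᵐ t ∂(AddCircle.haarAddCircle : Measure UnitAddCircle), p.eval (pt t) ≠ 0 := by
  have hf : {t : UnitAddCircle | p.eval (pt t) = 0}.Finite := by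
    have h1 : ({z : ℂ | p.IsRoot z}).Finite := p.finite_setOfPred_isRoot hp
    refine h1.preimage (Function.Injective.injOn ?_)
    exact Subtype.val_injective.comp (AddCircle.injective_toCircle one_ne_zero)
  have : (AddCircle.haarAddCircle : Measure UnitAddCircle)
      {t : UnitAddCircle | p.eval (pt t) = 0} = 0 := by
    have h1 : ∀ x : UnitAddCircle, volume ({x} : Set UnitAddCircle) = 0 := fun x => by
      have := AddCircle.volume_closedBall (T := 1) (x := x) 0
      simpa using this
    have h : volume {t : UnitAddCircle | p.eval (pt t) = 0} = 0 := by
      rw [← Set.biUnion_of_singleton {t : UnitAddCircle | p.eval (pt t) = 0}]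
      exact (measure_biUnion_null_iff hf.countable).2 fun x _ => h1 x
    simpa [AddCircle.volume_eq_smul_haarAddCircle] using h
  simpa [ae_iff] using this

theorem ae_ev_add (x y : RatFunc ℂ) :
    ∀ᵐ t ∂(AddCircle.haarAddCircle : Measure UnitAddCircle),
      ev (x + y) (pt t) = ev x (pt t) + ev y (pt t) := by
  filter_upwards [ae_eval_ne_zero _ x.denom_ne_zero, ae_eval_ne_zero _ y.denom_ne_zero]
    with t hx hy
  exact RatFunc.eval_add _ _ (by simpa [eval₂_id] using hx) (by simpa [eval₂_id] using hy)

theorem ae_ev_C_mul (c : ℂ) (x : RatFunc ℂ) :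
    ∀ᵐ t ∂(AddCircle.haarAddCircle : Measure UnitAddCircle),
      ev (RatFunc.C c * x) (pt t) = c * ev x (pt t) := by
  filter_upwards [ae_eval_ne_zero _ x.denom_ne_zero] with t hx
  rw [ev, RatFunc.eval_mul _ _ (by simp) (by simpa [eval₂_id] using hx), RatFunc.eval_C]
  rfl

/-- The composition of a strictly proper rational function with the parametrization of the circle
is square integrable only if the function has no poles on the circle; for a function in `Rat₀(𝕋)`
this means that it vanishes. -/
theorem eq_zero_of_mem_Rat0T {ρ : RatFunc ℂ} (hρ : ρ ∈ Rat0T) (f : L2T)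
    (hf : ∀ᵐ t ∂(AddCircle.haarAddCircle : Measure UnitAddCircle), f t = ev ρ (pt t)) :
    ρ = 0 := by
  by_cases hroot : ∃ z, ρ.denom.IsRoot z
  · exfalso
    obtain ⟨ζ, hζ⟩ := hroot
    have hζ1 := hρ.1 ζ hζ
    obtain ⟨t₀, ht₀⟩ : ∃ t : UnitAddCircle, pt t = ζ := by
      obtain ⟨t, ht⟩ := (AddCircle.homeomorphCircle (T := 1) one_ne_zero).surjective
        ⟨ζ, by simpa [Submonoid.unitSphere] using hζ1⟩
      refine ⟨t, ?_⟩
      rw [AddCircle.homeomorphCircle_apply] at ht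
      rw [pt, ht]
    obtain ⟨x₀, rfl⟩ := QuotientAddGroup.mk_surjective t₀
    let e : ℝ → ℂ := fun x => pt (x : UnitAddCircle)
    have he : e = fun x : ℝ => Complex.exp (2 * Real.pi * x * Complex.I) := by
      funext x
      have := fourier_coe_apply (T := 1) (n := 1) (x := x)
      rw [fourier_one] at this
      simp only [e, pt]
      rw [this]
      congr 1
      push_cast
      ring
    have hed : Differentiable ℝ e := by
      rw [he]
      have : Differentiable ℝ fun x : ℝ => (x : ℂ) := Complex.ofRealCLM.differentiable
      fun_prop
    have hpd : ∀ p : ℂ[X], Differentiable ℝ fun x => p.eval (e x) := fun p =>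
      (p.differentiable.restrictScalars ℝ).comp hed
    have hint : IntervalIntegrable (fun x : ℝ => ev ρ (e x)) volume
        (x₀ - 1 / 2) (x₀ - 1 / 2 + 1) := by
      rw [intervalIntegrable_iff_integrableOn_Ioc_of_le (by linarith)]
      have h1 : Integrable (fun t => ev ρ (pt t))
          (AddCircle.haarAddCircle : Measure UnitAddCircle) :=
        ((Lp.memLp f).integrable (by norm_num)).congr hf
      have h2 : Integrable (fun t => ev ρ (pt t)) (volume : Measure UnitAddCircle) := by
        rw [AddCircle.volume_eq_smul_haarAddCircle]
        simpa using h1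
      exact (AddCircle.measurePreserving_mk 1 (x₀ - 1 / 2)).integrable_comp_of_integrable h2
    refine not_intervalIntegrable_of_sub_inv_isBigO_punctured (c := x₀) ?_ (by simp)
      (by rw [Set.uIcc_of_le (by linarith)]; constructor <;> linarith) hint
    have hnum : ρ.num.eval (e x₀) ≠ 0 := by
      intro h0
      have hz : ρ.denom.eval (e x₀) = 0 := by
        simpa [e, ht₀] using hζ
      obtain ⟨u, v, huv⟩ := ρ.isCoprime_num_denom
      have := congrArg (eval (e x₀)) huv
      simp [h0, hz] at this
    have hO : (fun x => ρ.denom.eval (e x) / ρ.num.eval (e x)) =O[nhds x₀] fun x => x - x₀ := by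
      have hd : DifferentiableAt ℝ (fun x => ρ.denom.eval (e x) / ρ.num.eval (e x)) x₀ :=
        ((hpd _) x₀).div ((hpd _) x₀) hnum
      have hz : ρ.denom.eval (e x₀) = 0 := by
        simpa [e, ht₀] using hζ
      simpa [hz] using hd.isBigO_sub
    have hne : ∀ᶠ x in nhdsWithin x₀ {x₀}ᶜ, ρ.denom.eval (e x) ≠ 0 := by
      have hfin : {x : ℝ | x ∈ Set.Ico (x₀ - 1 / 2) (x₀ - 1 / 2 + 1) ∧
          ρ.denom.eval (e x) = 0}.Finite := by
        refine Set.Finite.of_injOn (f := e) (t := {z | ρ.denom.IsRoot z}) (fun x hx => hx.2) ?_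
          (ρ.denom.finite_setOfPred_isRoot ρ.denom_ne_zero)
        intro x hx y hy hxy
        have h1 : (x : UnitAddCircle) = y :=
          AddCircle.injective_toCircle one_ne_zero (Subtype.val_injective hxy)
        exact (AddCircle.coe_eq_coe_iff_of_mem_Ico hx.1 hy.1).1 h1
      have h3 := (hfin.subset (Set.sdiff_subset (t := {x₀}))).isClosed.isOpen_compl.mem_nhds
        (x := x₀) (by simp)
      have h4 : Set.Ico (x₀ - 1 / 2) (x₀ - 1 / 2 + 1) ∈ nhds x₀ :=
        Ico_mem_nhds (by linarith) (by linarith)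
      filter_upwards [nhdsWithin_le_nhds h3, nhdsWithin_le_nhds h4, self_mem_nhdsWithin]
        with x hx1 hx2 hx3 hx4
      exact hx1 ⟨⟨hx2, hx4⟩, hx3⟩
    have hne' : ∀ᶠ x in nhdsWithin x₀ {x₀}ᶜ, ρ.num.eval (e x) ≠ 0 :=
      nhdsWithin_le_nhds ((hpd ρ.num).continuous.continuousAt.eventually_ne hnum)
    have := (hO.mono nhdsWithin_le_nhds).inv_rev (l := nhdsWithin x₀ {x₀}ᶜ) ?_
    · refine this.congr_right fun x => ?_
      simp [ev, RatFunc.eval, eval₂_id]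
    · filter_upwards [hne, hne'] with x h1 h2 h3
      exact absurd h3 (div_ne_zero h1 h2)
  · have hd : ρ.denom.degree = 0 := by
      by_contra h
      exact hroot (Complex.exists_root (lt_of_le_of_ne
        (zero_le_degree_iff.2 ρ.denom_ne_zero) (Ne.symm h)))
    have := hρ.2
    rw [hd, Nat.WithBot.lt_zero_iff, degree_eq_bot] at this
    exact RatFunc.num_eq_zero_iff.1 this

/-! ### The Toeplitz-like operator -/

/-- The graph of the Toeplitz-like operator with symbol `ω`: pairs `(g, ℙ f)` with `g ∈ H²`,
`f ∈ L²(𝕋)` and `ω g = f + ρ` (almost everywhere on `𝕋`) for some `ρ ∈ Rat₀(𝕋)`. -/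
noncomputable def toeplitzGraph (ω : RatFunc ℂ) : Submodule ℂ (H2 × H2) where
  carrier := {x | ∃ f : L2T, ∃ ρ ∈ Rat0T,
    (∀ᵐ t ∂(AddCircle.haarAddCircle : Measure UnitAddCircle),
      ev ω (pt t) * (x.1 : L2T) t = f t + ev ρ (pt t)) ∧ x.2 = rieszProj f}
  add_mem' := by
    rintro x y ⟨f, ρ, hρ, h, hx⟩ ⟨f', ρ', hρ', h', hy⟩
    refine ⟨f + f', ρ + ρ', Rat0T_add hρ hρ', ?_, by simp [hx, hy]⟩
    rw [Prod.fst_add, Submodule.coe_add]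
    filter_upwards [h, h', ae_ev_add ρ ρ', Lp.coeFn_add f f',
      Lp.coeFn_add (x.1 : L2T) (y.1 : L2T)] with t h1 h2 h3 h4 h5
    rw [h3, h4, h5, Pi.add_apply, Pi.add_apply, mul_add, h1, h2]
    ring
  zero_mem' := by
    refine ⟨0, 0, Rat0T_zero, ?_, by simp⟩
    rw [Prod.fst_zero, Submodule.coe_zero]
    filter_upwards [Lp.coeFn_zero ℂ 2 (AddCircle.haarAddCircle : Measure UnitAddCircle)]
      with t h1
    rw [h1]
    simp [ev]
  smul_mem' := by
    rintro c x ⟨f, ρ, hρ, h, hx⟩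
    refine ⟨c • f, RatFunc.C c * ρ, Rat0T_C_mul c hρ, ?_, by simp [hx]⟩
    rw [Prod.smul_fst, Submodule.coe_smul]
    filter_upwards [h, ae_ev_C_mul c ρ, Lp.coeFn_smul c f, Lp.coeFn_smul c (x.1 : L2T)]
      with t h1 h2 h3 h4
    rw [h2, h3, h4, Pi.smul_apply, Pi.smul_apply, smul_eq_mul, smul_eq_mul, mul_left_comm, h1]
    ring

theorem toeplitzGraph_single (ω : RatFunc ℂ) (x : H2 × H2) (hx : x ∈ toeplitzGraph ω)
    (h : x.1 = 0) : x.2 = 0 := by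
  obtain ⟨f, ρ, hρ, hf, hx2⟩ := hx
  rw [h, Submodule.coe_zero] at hf
  have h0 := Lp.coeFn_zero ℂ 2 (AddCircle.haarAddCircle : Measure UnitAddCircle)
  have hρ0 : ρ = 0 := by
    refine eq_zero_of_mem_Rat0T hρ (-f) ?_
    filter_upwards [hf, h0, Lp.coeFn_neg f] with t h1 h2 h3
    rw [h2, Pi.zero_apply, mul_zero] at h1
    rw [h3, Pi.neg_apply]
    linear_combination h1
  have hf0 : f = 0 := by
    refine Lp.ext ?_
    filter_upwards [hf, h0] with t h1 h2
    rw [h2, Pi.zero_apply, mul_zero, hρ0] at h1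
    rw [h2, Pi.zero_apply]
    simpa [ev] using h1.symm
  rw [hx2, hf0, map_zero]

/-- The Toeplitz-like operator `T_ω` on `H²` with rational symbol `ω`: its domain is
`{g ∈ H² : ω g = f + ρ with f ∈ L²(𝕋), ρ ∈ Rat₀(𝕋)}`, and `T_ω g = ℙ f`. -/
noncomputable def toeplitz (ω : RatFunc ℂ) : H2 →ₗ.[ℂ] H2 := (toeplitzGraph ω).toLinearPMap

theorem mem_toeplitz_domain (ω : RatFunc ℂ) (g : H2) :
    g ∈ (toeplitz ω).domain ↔ ∃ f : L2T, ∃ ρ ∈ Rat0T,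
      ∀ᵐ t ∂(AddCircle.haarAddCircle : Measure UnitAddCircle),
        ev ω (pt t) * (g : L2T) t = f t + ev ρ (pt t) := by
  rw [toeplitz, Submodule.toLinearPMap_domain]
  constructor
  · rintro ⟨x, ⟨f, ρ, hρ, h, -⟩, rfl⟩
    exact ⟨f, ρ, hρ, h⟩
  · rintro ⟨f, ρ, hρ, h⟩
    exact ⟨(g, rieszProj f), ⟨f, ρ, hρ, h, rfl⟩, rfl⟩

theorem toeplitz_apply (ω : RatFunc ℂ) (g : (toeplitz ω).domain) (f : L2T) {ρ : RatFunc ℂ}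
    (hρ : ρ ∈ Rat0T)
    (h : ∀ᵐ t ∂(AddCircle.haarAddCircle : Measure UnitAddCircle),
      ev ω (pt t) * (g : L2T) t = f t + ev ρ (pt t)) :
    toeplitz ω g = rieszProj f := by
  have h1 : ((g : H2), toeplitz ω g) ∈ toeplitzGraph ω :=
    Submodule.mem_graph_toLinearPMap (toeplitzGraph_single ω) g
  have h2 : ((g : H2), rieszProj f) ∈ toeplitzGraph ω := ⟨f, ρ, hρ, h, rfl⟩
  have h3 := toeplitzGraph_single ω _ ((toeplitzGraph ω).sub_mem h1 h2) (by simp)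
  exact sub_eq_zero.1 h3

/-- The subspace `q H²` of `H²`, for a polynomial `q`. -/
noncomputable def mulH2 (q : ℂ[X]) : Submodule ℂ H2 where
  carrier := {f | ∃ h : H2, ∀ᵐ t ∂(AddCircle.haarAddCircle : Measure UnitAddCircle),
    (f : L2T) t = q.eval (pt t) * (h : L2T) t}
  add_mem' := by
    rintro f g ⟨h, hf⟩ ⟨k, hg⟩
    refine ⟨h + k, ?_⟩
    rw [Submodule.coe_add, Submodule.coe_add]
    filter_upwards [hf, hg, Lp.coeFn_add (f : L2T) (g : L2T), Lp.coeFn_add (h : L2T) (k : L2T)]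
      with t h1 h2 h3 h4
    rw [h3, h4, Pi.add_apply, Pi.add_apply, h1, h2, mul_add]
  zero_mem' := by
    refine ⟨0, ?_⟩
    rw [Submodule.coe_zero]
    filter_upwards [Lp.coeFn_zero ℂ 2 (AddCircle.haarAddCircle : Measure UnitAddCircle)]
      with t h1
    rw [h1, Pi.zero_apply, mul_zero]
  smul_mem' := by
    rintro c f ⟨h, hf⟩
    refine ⟨c • h, ?_⟩
    rw [Submodule.coe_smul, Submodule.coe_smul]
    filter_upwards [hf, Lp.coeFn_smul c (f : L2T), Lp.coeFn_smul c (h : L2T)] with t h1 h2 h3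
    rw [h2, h3, Pi.smul_apply, Pi.smul_apply, h1, smul_eq_mul, smul_eq_mul, mul_left_comm]

end HardyToeplitz

namespace HardyToeplitz

/-! ### Multiplication by polynomials -/

/-! For (i), let `u s + v q = 1`. If `g = (s/q) f` on the disc, then `k = u g + v f` satisfies `f =
q k` and `g = s k`, so the graph of Sarason's operator is `{(q k, s k) : k ∈ H²}`
(`mem_sarasonGraph_iff`). Such pairs lie in the graph of `T_ω` with `ρ = 0`, and that graph is
single-valued.

For (ii), put `m = deg q` and let `q' = z^m conj q`, `s' = z^m conj s` on the circle; by properness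
both are polynomials, and `ω^* = s'/q'` in lowest terms.

Sarason's operator is contained in the adjoint: if `(g, v)` is in the graph of `T_ω`, with `v = ℙ
f`, then `s g = q f + r` with `r` a polynomial of degree less than `m`. Hence `⟨g, s' k⟩ - ⟨v, q' k⟩
= ⟨s g - q f, z^m k⟩ = ⟨r, z^m k⟩ = 0` for all `k ∈ H²` (`inner_eq_of_mem_toeplitzGraph`), and by
(i) the pairs `(q' k, s' k)` form the graph of Sarason's operator for `ω^*`.

For the converse, `T_ω` is tested on the polynomial parts `g_n` of `q z^n / z^m`; it maps them to
the polynomial parts `b_n` of `s z^n / z^m`. The `n`-th coefficients of `q' w` and `s' h` are `⟨g_n,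
w⟩` and `⟨b_n, h⟩` (`IsReflection.fourierCoeff_mulPoly`), so a pair `(h, w)` in the adjoint graph
satisfies `q' w = s' h`, that is, `w = ω^* h` on the disc.

Density uses the same coefficient formula together with the fact that a nonzero element of `Rat₀(𝕋)`
is never square integrable. -/

theorem continuous_pt : Continuous pt :=
  continuous_subtype_val.comp AddCircle.continuous_toCircle

theorem norm_pt (t : UnitAddCircle) : ‖pt t‖ = 1 := Circle.norm_coe _

theorem memLp_eval_mul (p : ℂ[X]) (f : L2T) :
    MemLp (fun t => p.eval (pt t) * f t) 2 AddCircle.haarAddCircle := by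
  have hc : Continuous fun t => p.eval (pt t) := p.continuous.comp continuous_pt
  obtain ⟨C, hC⟩ := isCompact_univ.exists_bound_of_continuousOn hc.continuousOn
  have hp : MemLp (fun t => p.eval (pt t)) ⊤ AddCircle.haarAddCircle :=
    memLp_top_of_bound hc.aestronglyMeasurable C (.of_forall fun t => hC t (Set.mem_univ t))
  exact (Lp.memLp f).mul hp

/-- Multiplication by a polynomial on `L²(𝕋)`. -/
noncomputable def mulL2 (p : ℂ[X]) (f : L2T) : L2T := (memLp_eval_mul p f).toLp _

theorem coeFn_mulL2 (p : ℂ[X]) (f : L2T) :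
    ∀ᵐ t ∂AddCircle.haarAddCircle, mulL2 p f t = p.eval (pt t) * f t :=
  (memLp_eval_mul p f).coeFn_toLp

theorem mulL2_add_left (p q : ℂ[X]) (f : L2T) : mulL2 (p + q) f = mulL2 p f + mulL2 q f := by
  refine Lp.ext ?_
  filter_upwards [coeFn_mulL2 (p + q) f, coeFn_mulL2 p f, coeFn_mulL2 q f,
    Lp.coeFn_add (mulL2 p f) (mulL2 q f)] with t h1 h2 h3 h4
  rw [h1, h4, Pi.add_apply, h2, h3, eval_add, add_mul]

theorem mulL2_mul (p q : ℂ[X]) (f : L2T) : mulL2 (p * q) f = mulL2 p (mulL2 q f) := by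
  refine Lp.ext ?_
  filter_upwards [coeFn_mulL2 (p * q) f, coeFn_mulL2 p (mulL2 q f), coeFn_mulL2 q f]
    with t h1 h2 h3
  rw [h1, h2, h3, eval_mul, mul_assoc]

theorem mulL2_C (c : ℂ) (f : L2T) : mulL2 (C c) f = c • f := by
  refine Lp.ext ?_
  filter_upwards [coeFn_mulL2 (C c) f, Lp.coeFn_smul c f] with t h1 h2
  rw [h1, h2, eval_C, Pi.smul_apply, smul_eq_mul]

theorem fourierCoeff_mulL2_X (f : L2T) (n : ℤ) :
    fourierCoeff (mulL2 X f) n = fourierCoeff f (n - 1) := by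
  refine integral_congr_ae ?_
  filter_upwards [coeFn_mulL2 X f] with t h
  rw [h, eval_X, smul_eq_mul, smul_eq_mul, ← mul_assoc]
  congr 1
  rw [pt, show -(n - 1) = -n + 1 by ring, fourier_add, fourier_one]

theorem fourierCoeff_mulL2_X_pow (k : ℕ) (f : L2T) (n : ℤ) :
    fourierCoeff (mulL2 (X ^ k) f) n = fourierCoeff f (n - k) := by
  induction k generalizing n with
  | zero => rw [pow_zero, ← C_1, mulL2_C, one_smul]; simp
  | succ k ih =>
    rw [pow_succ', mulL2_mul, fourierCoeff_mulL2_X, ih]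
    push_cast
    congr 1
    ring

theorem fourierCoeff_mulL2 (p : ℂ[X]) (f : L2T) (n : ℤ) :
    fourierCoeff (mulL2 p f) n = p.sum fun k a => a * fourierCoeff f (n - k) := by
  induction p using Polynomial.induction_on' with
  | add p q hp hq =>
    rw [mulL2_add_left, fourierCoeff_add', hp, hq,
      sum_add_index p q _ (by simp) (by intros; ring)]
  | monomial k a =>
    rw [← C_mul_X_pow_eq_monomial, mulL2_mul, mulL2_C, fourierCoeff_smul',
      fourierCoeff_mulL2_X_pow, C_mul_X_pow_eq_monomial, sum_monomial_index _ _ (by simp)]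

theorem mulL2_mem_H2 (p : ℂ[X]) {f : L2T} (hf : f ∈ H2) : mulL2 p f ∈ H2 := fun n hn => by
  rw [fourierCoeff_mulL2]
  refine Finset.sum_eq_zero fun k _ => ?_
  dsimp only
  rw [hf _ (by omega), mul_zero]

/-- Multiplication by a polynomial on `H²`. -/
noncomputable def mulPoly (p : ℂ[X]) (f : H2) : H2 := ⟨mulL2 p f, mulL2_mem_H2 p f.2⟩

theorem coe_mulPoly (p : ℂ[X]) (f : H2) : (mulPoly p f : L2T) = mulL2 p f := rfl

theorem coeFn_mulPoly (p : ℂ[X]) (f : H2) :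
    ∀ᵐ t ∂AddCircle.haarAddCircle, (mulPoly p f : L2T) t = p.eval (pt t) * (f : L2T) t :=
  coeFn_mulL2 p f

theorem mulPoly_add_left (p q : ℂ[X]) (f : H2) :
    mulPoly (p + q) f = mulPoly p f + mulPoly q f :=
  Subtype.ext (mulL2_add_left p q f)

theorem mulPoly_mul (p q : ℂ[X]) (f : H2) : mulPoly (p * q) f = mulPoly p (mulPoly q f) :=
  Subtype.ext (mulL2_mul p q f)

theorem mulPoly_C (c : ℂ) (f : H2) : mulPoly (C c) f = c • f :=
  Subtype.ext (mulL2_C c f)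

theorem disc_mulPoly_X (f : H2) {z : ℂ} (hz : ‖z‖ < 1) :
    disc (mulPoly X f) z = z * disc f z := by
  have h := (summable_disc (mulPoly X f) hz).tsum_eq_zero_add
  rw [disc, h, coe_mulPoly, disc, ← tsum_mul_left]
  simp_rw [fourierCoeff_mulL2_X]
  -- The constant term of `z f` is the coefficient of `f` at index `-1`, which vanishes.
  rw [f.2 _ (by norm_num)]
  simp only [zero_mul, zero_add]
  refine tsum_congr fun n => ?_
  push_cast
  rw [add_sub_cancel_right]
  ring

theorem disc_mulPoly (p : ℂ[X]) (f : H2) {z : ℂ} (hz : ‖z‖ < 1) :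
    disc (mulPoly p f) z = p.eval z * disc f z := by
  induction p using Polynomial.induction_on generalizing f with
  | C a => rw [mulPoly_C, disc_smul, eval_C]
  | add p q hp hq => rw [mulPoly_add_left, disc_add _ _ hz, hp, hq, eval_add, add_mul]
  | monomial n a h =>
    rw [pow_succ, ← mul_assoc, mulPoly_mul, h, disc_mulPoly_X f hz]
    simp only [eval_mul, eval_C, eval_pow, eval_X]
    ring

theorem disc_sub (f g : H2) {z : ℂ} (hz : ‖z‖ < 1) : disc (f - g) z = disc f z - disc g z := by
  rw [eq_sub_iff_add_eq, ← disc_add _ _ hz, sub_add_cancel]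

theorem disc_injective {f g : H2} (h : ∀ z : ℂ, ‖z‖ < 1 → disc f z = disc g z) : f = g :=
  sub_eq_zero.1 <| eq_zero_of_disc_eq_zero _ fun z hz => by
    rw [disc_sub _ _ hz, h z hz, sub_self]

/-! ### Polynomials as elements of the Hardy space -/

theorem ext_fourierCoeff {f g : L2T} (h : ∀ n, fourierCoeff f n = fourierCoeff g n) : f = g := by
  refine fourierBasis.repr.injective ?_
  ext n
  rw [fourierBasis_repr, fourierBasis_repr, h]

theorem fourierCoeff_fourierLp_zero (n : ℤ) :
    fourierCoeff (fourierLp 2 0 : L2T) n = if n = 0 then 1 else 0 := by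
  rw [← fourierBasis_repr, HilbertBasis.repr_apply_apply, coe_fourierBasis,
    orthonormal_iff_ite.1 orthonormal_fourier]

/-- The constant function `1` as an element of `H²`. -/
noncomputable def oneH2 : H2 :=
  ⟨fourierLp 2 0, fun n hn => by rw [fourierCoeff_fourierLp_zero, if_neg hn.ne]⟩

theorem coeFn_oneH2 : ∀ᵐ t ∂AddCircle.haarAddCircle, (oneH2 : L2T) t = 1 := by
  filter_upwards [coeFn_fourierLp (T := 1) 2 0] with t h
  exact h.trans fourier_zero

/-- A polynomial as an element of `H²`. -/
noncomputable def polyH2 (p : ℂ[X]) : H2 := mulPoly p oneH2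

theorem coeFn_polyH2 (p : ℂ[X]) :
    ∀ᵐ t ∂AddCircle.haarAddCircle, (polyH2 p : L2T) t = p.eval (pt t) := by
  filter_upwards [coeFn_mulPoly p oneH2, coeFn_oneH2] with t h1 h2
  rw [polyH2, h1, h2, mul_one]

theorem fourierCoeff_polyH2 (p : ℂ[X]) (n : ℕ) :
    fourierCoeff (polyH2 p : L2T) n = p.coeff n := by
  rw [polyH2, coe_mulPoly, fourierCoeff_mulL2, oneH2]
  simp only [fourierCoeff_fourierLp_zero, sub_eq_zero, Nat.cast_inj, mul_ite, mul_one, mul_zero]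
  rw [Polynomial.sum, Finset.sum_ite_eq]
  simp [eq_comm]

theorem ext_H2 {f g : H2} (h : ∀ n : ℕ, fourierCoeff (f : L2T) n = fourierCoeff (g : L2T) n) :
    f = g := by
  refine Subtype.ext (ext_fourierCoeff fun n => ?_)
  rcases lt_or_ge n 0 with hn | hn
  · rw [f.2 n hn, g.2 n hn]
  · obtain ⟨k, rfl⟩ := Int.eq_ofNat_of_zero_le hn
    exact h k

/-- An element of `H²` whose Fourier coefficients vanish from index `m` on is a polynomial. -/
theorem exists_eq_polyH2 (f : H2) (m : ℕ)
    (hf : ∀ n : ℕ, m ≤ n → fourierCoeff (f : L2T) n = 0) :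
    ∃ r : ℂ[X], r.degree < m ∧ f = polyH2 r := by
  set r : ℂ[X] := ∑ i : Fin m, C (fourierCoeff (f : L2T) (i : ℕ)) * X ^ (i : ℕ) with hr
  have hd : r.degree < m := degree_sum_fin_lt _
  refine ⟨r, hd, ext_H2 fun n => ?_⟩
  rw [fourierCoeff_polyH2]
  rcases lt_or_ge n m with hn | hn
  · rw [hr, finsetSum_coeff]
    simp only [coeff_C_mul_X_pow]
    rw [Finset.sum_eq_single (⟨n, hn⟩ : Fin m)]
    · simp
    · rintro b - hb
      rw [if_neg]
      rintro rfl
      exact hb rfl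
    · simp
  · rw [hf n hn, coeff_eq_zero_of_degree_lt (hd.trans_le (by exact_mod_cast hn))]

theorem inner_eq_zero_of_fourierCoeff {f g : L2T}
    (h : ∀ n, fourierCoeff f n = 0 ∨ fourierCoeff g n = 0) : inner ℂ f g = 0 := by
  refine (fourierBasis.hasSum_inner_mul_inner f g).unique ?_
  convert hasSum_zero with n
  have hc : ∀ x : L2T, inner ℂ (fourierBasis n) x = fourierCoeff x n := fun x => by
    rw [← HilbertBasis.repr_apply_apply, fourierBasis_repr]
  rw [← inner_conj_symm, hc, hc]
  rcases h n with h | h <;> simp [h]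

/-- The polynomials of degree less than `m` are orthogonal to `z^m H²`. -/
theorem inner_polyH2_X_pow_mul {r : ℂ[X]} {m : ℕ} (hr : r.degree < m) (h : H2) :
    inner ℂ (polyH2 r : L2T) (mulL2 (X ^ m) h) = 0 := by
  refine inner_eq_zero_of_fourierCoeff fun n => ?_
  rcases lt_or_ge n m with hn | hn
  · exact .inr (by rw [fourierCoeff_mulL2_X_pow, h.2 _ (by omega)])
  · obtain ⟨k, rfl⟩ := Int.eq_ofNat_of_zero_le (by omega : 0 ≤ n)
    left
    rw [fourierCoeff_polyH2]
    exact coeff_eq_zero_of_degree_lt (hr.trans_le (by exact_mod_cast hn))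

/-- Turns coefficients into inner products, so that a multiplier can be moved to the other argument.
-/
theorem inner_X_pow_fourierCoeff (f : L2T) (n : ℕ) :
    inner ℂ (polyH2 (X ^ n) : L2T) f = fourierCoeff f n := by
  rw [L2.inner_def]
  refine integral_congr_ae ?_
  filter_upwards [coeFn_polyH2 (X ^ n)] with t h
  rw [h, RCLike.inner_apply, eval_pow, eval_X, smul_eq_mul, mul_comm]
  congr 1
  rw [fourier_neg, pt, fourier_apply, natCast_zsmul, AddCircle.toCircle_nsmul, Circle.coe_pow]

/-! ### Rational functions as quotients of polynomials -/

theorem ev_eq_div (ω : RatFunc ℂ) (z : ℂ) : ev ω z = ω.num.eval z / ω.denom.eval z := by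
  simp [ev, RatFunc.eval, eval₂_id]

theorem ev_div {s q : ℂ[X]} {z : ℂ} (hz : q.eval z ≠ 0) :
    ev (algebraMap ℂ[X] (RatFunc ℂ) s / algebraMap ℂ[X] (RatFunc ℂ) q) z =
      s.eval z / q.eval z := by
  have hq : q ≠ 0 := by rintro rfl; simp at hz
  set ω := algebraMap ℂ[X] (RatFunc ℂ) s / algebraMap ℂ[X] (RatFunc ℂ) q with hω
  have hd : ω.denom.eval z ≠ 0 := fun h =>
    hz (eval_eq_zero_of_dvd_of_eval_eq_zero (RatFunc.denom_div_dvd s q) h)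
  have h := congrArg (eval z) ((RatFunc.num_mul_eq_mul_denom_iff hq).2 hω)
  rw [eval_mul, eval_mul] at h
  rw [ev_eq_div, div_eq_div_iff hd hz, h]

theorem RootsOnCircle.of_dvd {p r : ℂ[X]} (hp : RootsOnCircle p) (h : r ∣ p) :
    RootsOnCircle r := fun z hz => hp z (hz.dvd h)

theorem div_mem_RatT {s q : ℂ[X]} (hq : RootsOnCircle q) :
    algebraMap ℂ[X] (RatFunc ℂ) s / algebraMap ℂ[X] (RatFunc ℂ) q ∈ RatT :=
  hq.of_dvd (RatFunc.denom_div_dvd s q)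

theorem div_mem_Rat0T {r q : ℂ[X]} (hq0 : q ≠ 0) (hq : RootsOnCircle q)
    (hr : r.degree < q.degree) :
    algebraMap ℂ[X] (RatFunc ℂ) r / algebraMap ℂ[X] (RatFunc ℂ) q ∈ Rat0T :=
  ⟨div_mem_RatT hq, degree_lt_of_mul_eq hq0 ((RatFunc.num_mul_eq_mul_denom_iff hq0).2 rfl)
    (RatFunc.denom_ne_zero _) hr⟩

/-- Cross-multiplying with the reduced fraction shows that `q` divides `s` times the reduced
denominator; coprimality removes `s`. -/
theorem rootsOnCircle_of_div_mem_RatT {s q : ℂ[X]} (hq : q ≠ 0) (hc : IsCoprime s q)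
    (h : algebraMap ℂ[X] (RatFunc ℂ) s / algebraMap ℂ[X] (RatFunc ℂ) q ∈ RatT) :
    RootsOnCircle q := by
  refine RootsOnCircle.of_dvd h (hc.symm.dvd_of_dvd_mul_left ?_)
  rw [← (RatFunc.num_mul_eq_mul_denom_iff hq).2 rfl]
  exact dvd_mul_left _ _

theorem RootsOnCircle.eval_ne_zero {q : ℂ[X]} (hq : RootsOnCircle q) {z : ℂ} (hz : ‖z‖ < 1) :
    q.eval z ≠ 0 := fun h => hz.ne (hq z h)

/-- If a function `r / d` in `Rat(𝕋)` is square integrable on the circle, then it is a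
polynomial. -/
theorem dvd_of_eval_mul_eq {r d : ℂ[X]} (hd : d.Monic) (hdT : RootsOnCircle d) (f : L2T)
    (hf : ∀ᵐ t ∂AddCircle.haarAddCircle, d.eval (pt t) * f t = r.eval (pt t)) : d ∣ r := by
  -- After the polynomial part is subtracted from `r / d`, what remains is strictly proper and still
  -- square integrable, hence zero.
  have hmem := div_mem_Rat0T hd.ne_zero hdT (degree_modByMonic_lt r hd)
  have h0 := eq_zero_of_mem_Rat0T hmem (f - polyH2 (r /ₘ d)) ?_
  · rw [div_eq_zero_iff] at h0
    rw [← modByMonic_eq_zero_iff_dvd hd]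
    simpa [hd.ne_zero] using h0
  · filter_upwards [hf, coeFn_polyH2 (r /ₘ d), ae_eval_ne_zero d hd.ne_zero,
      Lp.coeFn_sub f (polyH2 (r /ₘ d) : L2T)] with t h1 h2 h3 h4
    have h5 := congrArg (eval (pt t)) (modByMonic_add_div r d)
    rw [eval_add, eval_mul] at h5
    rw [h4, Pi.sub_apply, h2, ev_div h3, eq_div_iff h3]
    linear_combination h1 - h5

/-- If `ρ ∈ Rat₀(𝕋)` and `q ρ` is square integrable on the circle, then `q ρ` is a polynomial of
degree less than the degree of `q`. -/
theorem exists_polyH2_eq_mul {ρ : RatFunc ℂ} (hρ : ρ ∈ Rat0T) {q : ℂ[X]} (hq : q ≠ 0) (u : L2T)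
    (hu : ∀ᵐ t ∂AddCircle.haarAddCircle, u t = q.eval (pt t) * ev ρ (pt t)) :
    ∃ r : ℂ[X], r.degree < q.degree ∧ u = polyH2 r := by
  obtain ⟨r, hr⟩ : ρ.denom ∣ q * ρ.num := by
    refine dvd_of_eval_mul_eq ρ.monic_denom hρ.1 u ?_
    filter_upwards [hu, ae_eval_ne_zero _ ρ.denom_ne_zero] with t h1 h2
    rw [h1, ev_eq_div, eval_mul]
    field_simp
  refine ⟨r, degree_lt_of_mul_eq ρ.denom_ne_zero (by rw [mul_comm, ← hr, mul_comm]) hq hρ.2,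
    Lp.ext ?_⟩
  filter_upwards [hu, ae_eval_ne_zero _ ρ.denom_ne_zero, coeFn_polyH2 r] with t h1 h2 h3
  have h4 := congrArg (eval (pt t)) hr
  rw [eval_mul, eval_mul] at h4
  rw [h1, h3, ev_eq_div, mul_div_assoc', h4, mul_div_cancel_left₀ _ h2]

/-! ### The graphs of the two operators -/

/-- The graph of Sarason's operator with symbol `s / q` in lowest terms consists of the pairs
`(q k, s k)`. -/
theorem mem_sarasonGraph_iff {s q : ℂ[X]} (hc : IsCoprime s q) (hq : RootsOnCircle q)
    (f g : H2) :
    (f, g) ∈ sarasonGraph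
        (ev (algebraMap ℂ[X] (RatFunc ℂ) s / algebraMap ℂ[X] (RatFunc ℂ) q)) ↔
      ∃ k : H2, f = mulPoly q k ∧ g = mulPoly s k := by
  constructor
  · intro h
    obtain ⟨u, v, huv⟩ := hc
    -- Formally `k = f / q = g / s`; the Bézout relation expresses it without division, so it lies
    -- in `H²`.
    refine ⟨mulPoly u g + mulPoly v f, disc_injective fun z hz => ?_,
      disc_injective fun z hz => ?_⟩
    all_goals
      have h1 := h z hz
      have h2 := congrArg (eval z) huv
      -- The zeros of `q` are on the circle, so inside the disc `ev` never takes its default value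
      -- at a pole.
      have hz0 := hq.eval_ne_zero hz
      simp only [eval_add, eval_mul, eval_one] at h2
      rw [ev_div hz0] at h1
      rw [disc_mulPoly _ _ hz, disc_add _ _ hz, disc_mulPoly _ _ hz, disc_mulPoly _ _ hz, h1]
      field_simp
    · linear_combination -disc f z * h2
    · linear_combination -disc f z * s.eval z * h2
  · rintro ⟨k, rfl, rfl⟩ z hz
    have hz0 := hq.eval_ne_zero hz
    simp only [disc_mulPoly _ _ hz]
    rw [ev_div hz0]
    field_simp

theorem mem_sarasonGraph_of_mulPoly_eq {s q : ℂ[X]} (hq : RootsOnCircle q) {f g : H2}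
    (h : mulPoly q g = mulPoly s f) :
    (f, g) ∈ sarasonGraph
      (ev (algebraMap ℂ[X] (RatFunc ℂ) s / algebraMap ℂ[X] (RatFunc ℂ) q)) := fun z hz => by
  have hz0 := hq.eval_ne_zero hz
  have h1 := congrArg (fun f => disc f z) h
  simp only [disc_mulPoly _ _ hz] at h1
  rw [ev_div hz0]
  field_simp
  rw [mul_comm, h1]

theorem mem_graph_sarason {φ : ℂ → ℂ} {x : H2 × H2} :
    x ∈ (sarason φ).graph ↔ x ∈ sarasonGraph φ := by
  rw [sarason, Submodule.toLinearPMap_graph_eq _ (sarasonGraph_single φ)]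

theorem mem_graph_toeplitz {ω : RatFunc ℂ} {x : H2 × H2} :
    x ∈ (toeplitz ω).graph ↔ x ∈ toeplitzGraph ω := by
  rw [toeplitz, Submodule.toLinearPMap_graph_eq _ (toeplitzGraph_single ω)]

theorem rieszProj_coe (f : H2) : rieszProj (f : L2T) = f :=
  Submodule.orthogonalProjectionOnto_mem_subspace_eq_self f

theorem mem_mulH2_iff {q : ℂ[X]} {f : H2} : f ∈ mulH2 q ↔ ∃ k, f = mulPoly q k := by
  refine exists_congr fun k => ⟨fun h => Subtype.ext (Lp.ext ?_), ?_⟩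
  · filter_upwards [h, coeFn_mulPoly q k] with t h1 h2
    rw [h1, h2]
  · rintro rfl
    exact coeFn_mulPoly q k

theorem mulPoly_mem_toeplitzGraph {s q : ℂ[X]} (hq : q ≠ 0) (k : H2) :
    (mulPoly q k, mulPoly s k) ∈ toeplitzGraph
      (algebraMap ℂ[X] (RatFunc ℂ) s / algebraMap ℂ[X] (RatFunc ℂ) q) := by
  refine ⟨mulPoly s k, 0, Rat0T_zero, ?_, (rieszProj_coe _).symm⟩
  filter_upwards [coeFn_mulPoly s k, coeFn_mulPoly q k, ae_eval_ne_zero q hq] with t h1 h2 h3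
  rw [h1, h2, ev_div h3]
  simp only [ev, RatFunc.eval_zero, add_zero]
  field_simp

/-- Here `ρ = (s g - q b) / q`, and the degree condition says exactly that it is strictly proper.
This supplies all the test vectors used for density and for the adjoint. -/
theorem polyH2_mem_toeplitzGraph {s q g b : ℂ[X]} (hq0 : q ≠ 0) (hq : RootsOnCircle q)
    (h : (s * g - q * b).degree < q.degree) :
    (polyH2 g, polyH2 b) ∈ toeplitzGraph
      (algebraMap ℂ[X] (RatFunc ℂ) s / algebraMap ℂ[X] (RatFunc ℂ) q) := by
  refine ⟨polyH2 b, _, div_mem_Rat0T hq0 hq h, ?_, (rieszProj_coe _).symm⟩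
  filter_upwards [coeFn_polyH2 g, coeFn_polyH2 b, ae_eval_ne_zero q hq0] with t h1 h2 h3
  rw [h1, h2, ev_div h3, ev_div h3]
  simp only [eval_sub, eval_mul]
  field_simp
  ring

theorem sarason_eq_toeplitz_domRestrict {s q : ℂ[X]} (hq0 : q ≠ 0) (hc : IsCoprime s q)
    (hq : RootsOnCircle q) {ω : RatFunc ℂ}
    (hω : ω = algebraMap ℂ[X] (RatFunc ℂ) s / algebraMap ℂ[X] (RatFunc ℂ) q) :
    (sarason (ev ω)).domain = mulH2 q ∧
      sarason (ev ω) = (toeplitz ω).domRestrict (mulH2 q) := by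
  subst hω
  have hdom : (sarason (ev (algebraMap ℂ[X] (RatFunc ℂ) s / algebraMap ℂ[X] (RatFunc ℂ) q))).domain
      = mulH2 q := by
    ext f
    rw [LinearPMap.mem_domain_iff, mem_mulH2_iff]
    simp only [mem_graph_sarason, mem_sarasonGraph_iff hc hq]
    exact ⟨fun ⟨_, k, h, _⟩ => ⟨k, h⟩, fun ⟨k, h⟩ => ⟨_, k, h, rfl⟩⟩
  refine ⟨hdom, LinearPMap.ext ?_ ?_⟩
  · rw [hdom, LinearPMap.domRestrict_domain, eq_comm, inf_eq_left]
    intro f hf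
    obtain ⟨k, rfl⟩ := mem_mulH2_iff.1 hf
    exact LinearPMap.mem_domain_iff.2 ⟨_, mem_graph_toeplitz.2 (mulPoly_mem_toeplitzGraph hq0 k)⟩
  · intro f hf hf'
    obtain ⟨k, h1, h2⟩ := (mem_sarasonGraph_iff hc hq _ _).1
      (mem_graph_sarason.1 (LinearPMap.mem_graph _ ⟨f, hf⟩))
    have h3 := mem_graph_toeplitz.1 (LinearPMap.mem_graph _ (⟨f, hf'.2⟩ : (toeplitz _).domain))
    refine Eq.trans ?_ (LinearPMap.domRestrict_apply (x := ⟨f, hf'⟩)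
      (y := (⟨f, hf'.2⟩ : (toeplitz _).domain)) rfl).symm
    rw [h2]
    have h4 := mulPoly_mem_toeplitzGraph (s := s) hq0 k
    rw [← h1] at h4
    -- Both values are paired with the same `f` in the graph of `T_ω`, which is single-valued.
    exact sub_eq_zero.1 (toeplitzGraph_single _ _ (Submodule.sub_mem _ h4 h3) (by simp))

/-! ### Reflected polynomials -/

/-- The version valid off the circle is needed to locate the zeros of `sharp r`: they are the
reflections `1 / conj z` of nonzero zeros of `r`. -/
theorem eval_sharp_eq_mul_conj (r : ℂ[X]) {z : ℂ} (hz : z ≠ 0) :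
    (sharp r).eval z =
      z ^ r.natDegree * (starRingEnd ℂ) (r.eval ((starRingEnd ℂ) z)⁻¹) := by
  let i : Invertible z⁻¹ := invertibleOfNonzero (inv_ne_zero hz)
  have h := eval₂_reverse_mul_pow (RingHom.id ℂ) z⁻¹ (r.map (starRingEnd ℂ))
  have e : (⅟ (z⁻¹) : ℂ) = z := by simp
  have hc : z⁻¹ = (starRingEnd ℂ) ((starRingEnd ℂ) z)⁻¹ := by simp
  rw [e, natDegree_map, eval₂_id, eval₂_id, hc, eval_map, eval₂_hom, ← hc] at h
  rw [sharp, ← h, inv_pow]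
  field_simp

/-- The constant coefficient is the conjugate of the leading coefficient of `r`. -/
theorem eval_zero_sharp_ne_zero {r : ℂ[X]} (hr : r ≠ 0) : (sharp r).eval 0 ≠ 0 := by
  rw [sharp, ← coeff_zero_eq_eval_zero, coeff_zero_reverse]
  simpa using hr

theorem sharp_ne_zero {r : ℂ[X]} (hr : r ≠ 0) : sharp r ≠ 0 := fun h =>
  eval_zero_sharp_ne_zero hr (by rw [h, eval_zero])

theorem isRoot_of_isRoot_sharp {r : ℂ[X]} {z : ℂ} (hz : z ≠ 0) (h : (sharp r).eval z = 0) :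
    r.eval ((starRingEnd ℂ) z)⁻¹ = 0 := by
  rw [eval_sharp_eq_mul_conj r hz] at h
  simpa [hz] using h

theorem RootsOnCircle.sharp {q : ℂ[X]} (hq0 : q ≠ 0) (hq : RootsOnCircle q) :
    RootsOnCircle (sharp q) := fun z hz => by
  have hz0 : z ≠ 0 := by
    rintro rfl
    exact eval_zero_sharp_ne_zero hq0 hz
  simpa using hq _ (isRoot_of_isRoot_sharp hz0 hz)

/-- A common zero cannot be the origin, where `sharp q` does not vanish; any other one reflects to a
common zero of `s` and `q`. -/
theorem isCoprime_sharp {s q : ℂ[X]} (hq : q ≠ 0) (hc : IsCoprime s q) (k : ℕ) :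
    IsCoprime (X ^ k * sharp s) (sharp q) := by
  rw [isCoprime_iff_aeval_ne_zero_of_isAlgClosed ℂ ℂ]
  intro z
  simp only [coe_aeval_eq_eval]
  by_contra! h
  obtain ⟨hs, hq'⟩ := h
  have hz0 : z ≠ 0 := by
    rintro rfl
    exact eval_zero_sharp_ne_zero hq hq'
  have hs' : (sharp s).eval z = 0 := by simpa [hz0] using hs
  obtain ⟨u, v, huv⟩ := hc
  have := congrArg (eval ((starRingEnd ℂ) z)⁻¹) huv
  simp [isRoot_of_isRoot_sharp hz0 hs', isRoot_of_isRoot_sharp hz0 hq'] at this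

/-- Reversal loses degree only through a zero at the origin, and `q` has none. -/
theorem natDegree_sharp {q : ℂ[X]} (hq : RootsOnCircle q) : (sharp q).natDegree = q.natDegree := by
  have h0 : q.coeff 0 ≠ 0 := by
    rw [coeff_zero_eq_eval_zero]
    exact hq.eval_ne_zero (by simp)
  rw [sharp, reverse_natDegree, natDegree_map, natTrailingDegree_eq_zero.2, Nat.sub_zero]
  right
  simpa using h0

theorem ratStar_eq {ω : RatFunc ℂ} (hω : IsProper ω) :
    ratStar ω = algebraMap ℂ[X] (RatFunc ℂ)
        (X ^ (ω.denom.natDegree - ω.num.natDegree) * sharp ω.num) /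
      algebraMap ℂ[X] (RatFunc ℂ) (sharp ω.denom) := by
  have h : ω.num.natDegree ≤ ω.denom.natDegree := natDegree_le_natDegree hω
  have hX : algebraMap ℂ[X] (RatFunc ℂ) (X ^ ω.num.natDegree) ≠ 0 :=
    RatFunc.algebraMap_ne_zero (pow_ne_zero _ X_ne_zero)
  rw [ratStar]
  nth_rw 1 [← Nat.add_sub_cancel' h]
  rw [pow_add, mul_assoc, map_mul, map_mul _ (X ^ ω.num.natDegree), mul_div_mul_left _ _ hX]

/-! ### Inner products with reflected polynomials -/

/-- `p'` coincides with `z^m conj p` on the circle. -/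
def IsReflection (m : ℕ) (p p' : ℂ[X]) : Prop :=
  ∀ z : ℂ, ‖z‖ = 1 → p'.eval z = z ^ m * (starRingEnd ℂ) (p.eval z)

theorem isReflection_sharp (q : ℂ[X]) : IsReflection q.natDegree q (sharp q) :=
  fun _ hz => eval_sharp q hz

theorem isReflection_X_pow_mul_sharp {s : ℂ[X]} {m : ℕ} (h : s.natDegree ≤ m) :
    IsReflection m s (X ^ (m - s.natDegree) * sharp s) := fun z hz => by
  rw [eval_mul, eval_sharp s hz, eval_pow, eval_X, ← mul_assoc, ← pow_add, Nat.sub_add_cancel h]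

/-- The factor `conj p` of `p'` passes to the other argument as `p`, and `z^m` stays behind.
Polynomials of degree less than `m` then become invisible against `z^m H²`. -/
theorem IsReflection.inner_mulL2 {m : ℕ} {p p' : ℂ[X]} (h : IsReflection m p p') (a k : L2T) :
    inner ℂ a (mulL2 p' k) = inner ℂ (mulL2 p a) (mulL2 (X ^ m) k) := by
  rw [L2.inner_def, L2.inner_def]
  refine integral_congr_ae ?_
  filter_upwards [coeFn_mulL2 p' k, coeFn_mulL2 p a, coeFn_mulL2 (X ^ m) k] with t h1 h2 h3
  rw [h1, h2, h3, h _ (norm_pt t)]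
  simp only [RCLike.inner_apply, map_mul, eval_pow, eval_X]
  ring

theorem inner_mulL2_X_pow (m : ℕ) (a k : L2T) :
    inner ℂ (mulL2 (X ^ m) a) (mulL2 (X ^ m) k) = inner ℂ a k := by
  have h : IsReflection m (X ^ m) 1 := fun z hz => by
    simp only [eval_one, eval_pow, eval_X, map_pow]
    rw [← mul_pow, Complex.mul_conj, Complex.normSq_eq_norm_sq, hz]
    simp
  rw [← h.inner_mulL2, ← C_1, mulL2_C, one_smul]

/-- The coefficient is `⟨z^n, p' k⟩ = ⟨p z^n, z^m k⟩`. Divide `p z^n` by `z^m`: the remainder is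
orthogonal to `z^m H²`, and `z^m` cancels from the rest because it is unimodular. -/
theorem IsReflection.fourierCoeff_mulPoly {m : ℕ} {p p' : ℂ[X]} (h : IsReflection m p p')
    (k : H2) (n : ℕ) :
    fourierCoeff (mulPoly p' k : L2T) n = inner ℂ (polyH2 ((p * X ^ n) /ₘ X ^ m)) k := by
  have hm : (X ^ m : ℂ[X]).Monic := monic_X_pow m
  have hd : ((p * X ^ n) %ₘ X ^ m).degree < m := by
    simpa using degree_modByMonic_lt (p * X ^ n) hm
  have hdecomp : mulL2 p (polyH2 (X ^ n)) = (polyH2 ((p * X ^ n) %ₘ X ^ m) : L2T) +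
      mulL2 (X ^ m) (polyH2 ((p * X ^ n) /ₘ X ^ m)) := by
    conv_lhs => rw [polyH2, coe_mulPoly, ← mulL2_mul, ← modByMonic_add_div (p * X ^ n) (X ^ m)]
    rw [mulL2_add_left, mulL2_mul]
    rfl
  rw [← inner_X_pow_fourierCoeff, coe_mulPoly, h.inner_mulL2, hdecomp, inner_add_left,
    inner_polyH2_X_pow_mul hd, zero_add, inner_mulL2_X_pow, Submodule.coe_inner]

/-! ### The adjoint of the Toeplitz-like operator -/

variable {s q : ℂ[X]}

/-- If `f` is orthogonal to the domain, it is orthogonal to every `q z^j`. This kills the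
coefficients of `sharp q * f` from index `deg q` on, so `f` is a strictly proper rational function
with poles on the circle, and square integrability forces `f = 0`. -/
theorem dense_domain_toeplitz (hq0 : q ≠ 0) (hq : RootsOnCircle q) :
    Dense ((toeplitz (algebraMap ℂ[X] (RatFunc ℂ) s /
      algebraMap ℂ[X] (RatFunc ℂ) q)).domain : Set H2) := by
  rw [Submodule.dense_iff_topologicalClosure_eq_top, Submodule.topologicalClosure_eq_top_iff,
    Submodule.eq_bot_iff]
  intro f hf
  have hcoeff : ∀ n : ℕ, q.natDegree ≤ n → fourierCoeff (mulPoly (sharp q) f : L2T) n = 0 := by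
    intro n hn
    rw [(isReflection_sharp q).fourierCoeff_mulPoly]
    refine hf _ (LinearPMap.mem_domain_iff.2
      -- For `n ≥ deg q` the division is exact: the test vector is `q z^(n - deg q)`, with image `s
      -- z^(n - deg q)` and `ρ = 0`.
      ⟨polyH2 (s * X ^ (n - q.natDegree)), mem_graph_toeplitz.2 ?_⟩)
    have hdiv : q * X ^ n /ₘ X ^ q.natDegree = q * X ^ (n - q.natDegree) := by
      conv_lhs => rw [← Nat.sub_add_cancel hn, pow_add, ← mul_assoc, mul_comm]
      exact mul_divByMonic_cancel_left _ (monic_X_pow _)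
    rw [hdiv]
    refine polyH2_mem_toeplitzGraph hq0 hq ?_
    rw [show s * (q * X ^ (n - q.natDegree)) - q * (s * X ^ (n - q.natDegree)) = 0 by ring]
    rw [degree_zero]
    exact bot_lt_iff_ne_bot.2 (by simpa using hq0)
  obtain ⟨r, hr, hfr⟩ := exists_eq_polyH2 _ _ hcoeff
  have hs0 := sharp_ne_zero hq0
  have hmem : algebraMap ℂ[X] (RatFunc ℂ) r / algebraMap ℂ[X] (RatFunc ℂ) (sharp q) ∈ Rat0T := by
    refine div_mem_Rat0T hs0 (hq.sharp hq0) ?_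
    rwa [degree_eq_natDegree hs0, natDegree_sharp hq]
  have hval : ∀ᵐ t ∂AddCircle.haarAddCircle, (f : L2T) t =
      ev (algebraMap ℂ[X] (RatFunc ℂ) r / algebraMap ℂ[X] (RatFunc ℂ) (sharp q)) (pt t) := by
    filter_upwards [coeFn_mulPoly (sharp q) f, coeFn_polyH2 r, ae_eval_ne_zero _ hs0]
      with t h1 h2 h3
    rw [hfr, h2] at h1
    rw [ev_div h3, h1, mul_div_cancel_left₀ _ h3]
  have h0 := eq_zero_of_mem_Rat0T hmem f hval
  refine Subtype.ext (Lp.ext ?_)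
  rw [Submodule.coe_zero]
  filter_upwards [hval, Lp.coeFn_zero ℂ 2 (AddCircle.haarAddCircle : Measure UnitAddCircle)]
    with t h1 h2
  rw [h1, h2, h0]
  simp [ev]

/-- The pairing identity that makes `s' / q'` a formal adjoint symbol of `s / q`, when `s'` and `q'`
are the reflections of `s` and `q`. -/
theorem inner_eq_of_mem_toeplitzGraph {s' q' : ℂ[X]} (hq0 : q ≠ 0)
    (hs' : IsReflection q.natDegree s s') (hq' : IsReflection q.natDegree q q') {g v : H2}
    (hgv : (g, v) ∈ toeplitzGraph
      (algebraMap ℂ[X] (RatFunc ℂ) s / algebraMap ℂ[X] (RatFunc ℂ) q)) (k : H2) :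
    inner ℂ v (mulPoly q' k) = inner ℂ g (mulPoly s' k) := by
  obtain ⟨f, ρ, hρ, hf, hv⟩ := hgv
  -- Clearing denominators in `ω g = f + ρ` gives `s g - q f = q ρ`, which is square integrable and
  -- hence a polynomial `r`.
  obtain ⟨r, hr, hu⟩ := exists_polyH2_eq_mul hρ hq0 (mulL2 s g - mulL2 q f) (by
    filter_upwards [hf, coeFn_mulL2 s g, coeFn_mulL2 q f, ae_eval_ne_zero q hq0,
      Lp.coeFn_sub (mulL2 s g) (mulL2 q f)] with t h1 h2 h3 h4 h5
    rw [ev_div h4] at h1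
    rw [h5, Pi.sub_apply, h2, h3]
    field_simp at h1
    linear_combination h1)
  dsimp only at hv
  -- The projection drops out because `q' k` is in `H²`; both sides then become inner products with
  -- `z^m k`.
  rw [hv, rieszProj, Submodule.inner_orthogonalProjectionOnto_eq_of_mem_right, coe_mulPoly,
    hq'.inner_mulL2, Submodule.coe_inner, coe_mulPoly, hs'.inner_mulL2, eq_comm, ← sub_eq_zero,
    ← inner_sub_left, hu]
  rw [degree_eq_natDegree hq0] at hr
  exact inner_polyH2_X_pow_mul hr k

/-- Modulo the division remainders, both products equal `s q z^n / z^m`, so the leading parts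
cancel. Properness keeps the contribution of the remainders below degree `m`. -/
theorem degree_mul_divByMonic_X_pow_sub_lt (hq0 : q ≠ 0) (hsq : s.degree ≤ q.degree) (n : ℕ) :
    (s * ((q * X ^ n) /ₘ X ^ q.natDegree) - q * ((s * X ^ n) /ₘ X ^ q.natDegree)).degree <
      q.degree := by
  set m := q.natDegree with hm
  have hX : (X ^ m : ℂ[X]).Monic := monic_X_pow m
  have h1 := modByMonic_add_div (q * X ^ n) (X ^ m)
  have h2 := modByMonic_add_div (s * X ^ n) (X ^ m)
  have hd1 := degree_modByMonic_lt (q * X ^ n) hX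
  have hd2 := degree_modByMonic_lt (s * X ^ n) hX
  rw [degree_X_pow] at hd1 hd2
  set a := (q * X ^ n) %ₘ X ^ m
  set c := (s * X ^ n) %ₘ X ^ m
  set g := (q * X ^ n) /ₘ X ^ m
  set b := (s * X ^ n) /ₘ X ^ m
  have hqm : q.degree = m := degree_eq_natDegree hq0
  -- The remainders `a`, `c` have degree less than `m` while `q`, `s` have degree at most `m`, so
  -- the right side has degree less than `2m`.
  have hD : (s * g - q * b) * X ^ m = q * c - s * a := by linear_combination s * h1 - q * h2
  have hlt : (q * c - s * a).degree < m + m := by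
    refine (degree_sub_le _ _).trans_lt (max_lt ?_ ?_)
    · rw [degree_mul, hqm]
      exact WithBot.add_lt_add_left (by simp) hd2
    · rw [degree_mul]
      exact (add_le_add_left (hsq.trans_eq hqm) _).trans_lt (WithBot.add_lt_add_left (by simp) hd1)
  rw [← hD, degree_mul, degree_X_pow] at hlt
  rw [hqm]
  exact lt_of_add_lt_add_right hlt

theorem adjoint_toeplitz_eq_sarason (hq0 : q ≠ 0) (hq : RootsOnCircle q) (hc : IsCoprime s q)
    (hsq : s.degree ≤ q.degree) :
    (toeplitz (algebraMap ℂ[X] (RatFunc ℂ) s / algebraMap ℂ[X] (RatFunc ℂ) q)).adjoint =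
      sarason (ev (algebraMap ℂ[X] (RatFunc ℂ) (X ^ (q.natDegree - s.natDegree) * sharp s) /
        algebraMap ℂ[X] (RatFunc ℂ) (sharp q))) := by
  have hdense := dense_domain_toeplitz (s := s) hq0 hq
  have hrs := isReflection_X_pow_mul_sharp (natDegree_le_natDegree hsq)
  have hrq := isReflection_sharp q
  refine le_antisymm ?_ (LinearPMap.IsFormalAdjoint.le_adjoint hdense ?_)
  · refine LinearPMap.le_of_le_graph fun ⟨h, w⟩ hx => ?_
    rw [mem_graph_sarason]
    -- It suffices that `q' w = s' h`, which is checked coefficient by coefficient; each coefficient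
    -- is one instance of the adjoint relation, for the test vector `g_n` with image `b_n`.
    refine mem_sarasonGraph_of_mulPoly_eq (hq.sharp hq0) (ext_H2 fun n => ?_)
    rw [hrs.fourierCoeff_mulPoly, hrq.fourierCoeff_mulPoly]
    obtain ⟨y, rfl, rfl⟩ := (LinearPMap.mem_graph_iff _).1 hx
    obtain ⟨x, hx1, hx2⟩ := (LinearPMap.mem_graph_iff _).1 (mem_graph_toeplitz.2
      (polyH2_mem_toeplitzGraph hq0 hq (degree_mul_divByMonic_X_pow_sub_lt hq0 hsq n)))
    dsimp only at hx1 hx2 ⊢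
    rw [← hx1, ← hx2]
    exact ((LinearPMap.adjoint_isFormalAdjoint hdense).symm x y).symm
  · intro x y
    -- Since `s'` and `q'` are coprime, `y` and its image have the form `q' k` and `s' k`, to which
    -- the pairing identity applies.
    obtain ⟨k, h1, h2⟩ := (mem_sarasonGraph_iff (isCoprime_sharp hq0 hc _) (hq.sharp hq0) _ _).1
      (mem_graph_sarason.1 (LinearPMap.mem_graph _ y))
    rw [h1, h2]
    exact inner_eq_of_mem_toeplitzGraph hq0 hrs hrq
      (mem_graph_toeplitz.1 (LinearPMap.mem_graph _ x)) k

end HardyToeplitz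

theorem proposition6p1 :
    (∀ s q : ℂ[X], q ≠ 0 → IsCoprime s q →
      ∀ ω : RatFunc ℂ, ω = algebraMap ℂ[X] (RatFunc ℂ) s / algebraMap ℂ[X] (RatFunc ℂ) q →
        ω ∈ HardyToeplitz.RatT →
        (HardyToeplitz.sarason (HardyToeplitz.ev ω)).domain = HardyToeplitz.mulH2 q ∧
        HardyToeplitz.sarason (HardyToeplitz.ev ω) =
          (HardyToeplitz.toeplitz ω).domRestrict (HardyToeplitz.mulH2 q)) ∧
    (∀ ω : RatFunc ℂ, ω ∈ HardyToeplitz.RatT → HardyToeplitz.IsProper ω →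
      HardyToeplitz.ratStar ω ∈ HardyToeplitz.RatT ∧
      Dense ((HardyToeplitz.toeplitz ω).domain : Set HardyToeplitz.H2) ∧
      (HardyToeplitz.toeplitz ω).adjoint =
        HardyToeplitz.sarason (HardyToeplitz.ev (HardyToeplitz.ratStar ω))) := by
  refine ⟨fun s q hq hc ω hω hT => ?_, fun ω hT hP => ?_⟩
  · exact HardyToeplitz.sarason_eq_toeplitz_domRestrict hq hc
      (HardyToeplitz.rootsOnCircle_of_div_mem_RatT hq hc (hω ▸ hT)) hω
  · have hq0 := ω.denom_ne_zero
    have hdense := HardyToeplitz.dense_domain_toeplitz (s := ω.num) hq0 hT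
    have hadj := HardyToeplitz.adjoint_toeplitz_eq_sarason hq0 hT ω.isCoprime_num_denom hP
    rw [ω.num_div_denom] at hdense hadj
    rw [HardyToeplitz.ratStar_eq hP]
    exact ⟨HardyToeplitz.div_mem_RatT (HardyToeplitz.RootsOnCircle.sharp hq0 hT), hdense, hadj⟩
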